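/- Let $\kappa,\sigma>0$ and $\theta,x_0\in\mathbb R$, and let $(X_s)_{s\ge 0}$ be the Ornstein–Uhlenbeck process with $X_0=x_0$ (deterministic) and $dX_s=\kappa(\theta-X_s)\,ds+\sigma\,dW_s$, where $W$ is a standard Brownian motion. Let $n\ge 1$, let $0<t_1<\dots<t_n$ be sampling times, let $t'_i>t_i$ ($1\le i\le n$) be receiving times, and let $t>t'_n$. The observations are $Y_{t'_i}=X_{t_i}+N_{t'_i}$, where $\mathbf N=(N_{t'_1},\dots,N_{t'_n})^{T}$ is a Gaussian vector, independent of the process $X$, with mean zero and diagonal covariance matrix $\mathbf\Sigma_{\mathbf N}=\operatorname{diag}(\operatorname{Var}[N_{t'_1}],\dots,\operatorname{Var}[N_{t'_n}])$, all $\operatorname{Var}[N_{t'_i}]>0$. Let $\mathbf\Sigma_{\mathbf X}$ be the covariance matrix of $\mathbf X=(X_{t_1},\dots,X_{t_n})^{T}$. Then $\mathbf\Sigma_{\mathbf X}$, $\mathbf\Sigma_{\mathbf N}$ and $\mathbf A=\mathbf\Sigma_{\mathbf X}^{-1}+\mathbf\Sigma_{\mathbf N}^{-1}$ are invertible. Let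 $\mathbf A_{nn}$ be $\mathbf A$ with its $n$-th row and $n$-th column removed (with $\det\mathbf A_{nn}=1$ if $n=1$). Then the value of information $v(t)=I(X_t;Y_{t'_1},\dots,Y_{t'_n})$, that is, the mutual information (in nats) of $X_t$ and $(Y_{t'_1},\dots,Y_{t'_n})$, is finite and $$v(t)=\frac12\log\left(\frac{1-e^{-2\kappa t}}{1-e^{-2\kappa(t-t_n)}}\right)-\frac12\log\left(1+\frac{2\kappa}{\sigma^2\left(e^{2\kappa(t-t_n)}-1\right)}\,\frac{\det(\mathbf A_{nn})}{\det(\mathbf A)}\right).$$ -/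

import Mathlib

open MeasureTheory ProbabilityTheory InformationTheory
open scoped NNReal ENNReal

noncomputable section

namespace NoisyOU

variable {Ω : Type*} [MeasurableSpace Ω]

/-- `X` is an Ornstein–Uhlenbeck process with mean-reversion rate `κ`, long-term mean `θ`,
volatility `σ` and deterministic initial value `x₀`, driven by the standard Brownian motion `W`:
a process with almost surely continuous paths which solves
`dX_s = κ (θ - X_s) ds + σ dW_s`, `X_0 = x₀`.
Since `σ` is constant, `∫₀ˢ σ dW = σ W_s`, so the equation in integral form
needs only a path-by-path Lebesgue integral. -/
structure IsOrnsteinUhlenbeck (κ θ σ x₀ : ℝ) (X W : ℝ≥0 → Ω → ℝ) (P : Measure Ω) : Prop where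
  isBrownian : IsBrownianReal W P
  aemeasurable : ∀ s, AEMeasurable (X s) P
  continuous_paths : ∀ᵐ ω ∂P, Continuous fun s ↦ X s ω
  initial : ∀ᵐ ω ∂P, X 0 ω = x₀
  equation : ∀ᵐ ω ∂P, ∀ s : ℝ≥0,
    X s ω = X 0 ω + (∫ u in (0 : ℝ)..(s : ℝ), κ * (θ - X u.toNNReal ω)) + σ * W s ω

/-- The mutual information `I(U; V)` (in nats) of two random variables: the Kullback–Leibler
divergence of their joint law from the product of their marginal laws. -/
def mutualInfo {E F : Type*} [MeasurableSpace E] [MeasurableSpace F]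
    (U : Ω → E) (V : Ω → F) (P : Measure Ω) : ℝ≥0∞ :=
  klDiv (P.map fun ω ↦ (U ω, V ω)) ((P.map U).prod (P.map V))

/-- The value of information `v(t) = I(X_t; Y_{t'_1}, …, Y_{t'_n})` at time `t`, where
`τ' i` are the times at which the observations are received. -/
def voi {ι : Type*} (X Y : ℝ≥0 → Ω → ℝ) (τ' : ι → ℝ≥0) (P : Measure Ω) (t : ℝ≥0) : ℝ≥0∞ :=
  mutualInfo (X t) (fun ω i ↦ Y (τ' i) ω) P

/-- The covariance matrix of a random vector. -/
def covMatrix {ι : Type*} (Z : ι → Ω → ℝ) (P : Measure Ω) : Matrix ι ι ℝ :=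
  Matrix.of fun i j ↦ cov[Z i, Z j; P]

/-- The matrix `A = Σ_X⁻¹ + Σ_N⁻¹`, for random vectors `Z` and `N`. -/
def precisionSum {ι : Type*} [Fintype ι] [DecidableEq ι] (Z N : ι → Ω → ℝ) (P : Measure Ω) :
    Matrix ι ι ℝ :=
  (covMatrix Z P)⁻¹ + (covMatrix N P)⁻¹

/-- The matrix `A_{ij}` obtained from `A` by removing row `i` and column `j`. -/
def removeRowCol {n : ℕ} (A : Matrix (Fin (n + 1)) (Fin (n + 1)) ℝ) (i j : Fin (n + 1)) :
    Matrix (Fin n) (Fin n) ℝ :=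
  A.submatrix i.succAbove j.succAbove

end NoisyOU

end

open NoisyOU

/-! The triple of $X_t$, $\mathbf X$ and the noise is Gaussian, so $X_t$ is an affine function of
the observations plus an independent Gaussian residual $R$, and the mutual information is
$\frac12\log(\operatorname{Var}X_t/\operatorname{Var}R)$ (`mutualInfo_eq_of_gaussian_residual`). It
remains to compute $\operatorname{Var}R=\operatorname{Var}X_t-b^T(\Sigma_X+\Sigma_N)^{-1}b$, where
$b$ is the covariance of $X_t$ with $\mathbf X$.

With $\beta=e^{-\kappa(t-t_n)}$, the regression property (`IsOrnsteinUhlenbeck.covariance_of_le`)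
makes $b$ equal to $\beta$ times the last row of $\Sigma_X$. The Woodbury identity
$\Sigma_X-\Sigma_X(\Sigma_X+\Sigma_N)^{-1}\Sigma_X=A^{-1}$ then gives
$\operatorname{Var}R=\operatorname{Var}X_t-\beta^2\operatorname{Var}X_{t_n}+\beta^2(A^{-1})_{nn}$,
and Cramer's rule turns $(A^{-1})_{nn}$ into the quotient of determinants.

Gaussianity and the covariances come from the explicit solution of the equation. Its Wiener integral
$\int_0^s e^{\kappa u}\,dW_u$ has a smooth deterministic integrand, so it is defined path by path by
integration by parts. It is an almost sure limit of Stieltjes sums, which are linear in values of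
$W$, and such a limit stays Gaussian once the covariances converge
(`hasLaw_multivariateGaussian_of_tendsto`). -/

namespace NoisyOU

/-! ### Pathwise Stieltjes integrals of exponentials and variation of constants -/

open Filter Topology Set

/-- The pathwise value `∫₀ˢ exp (c u) dw(u)` of the Wiener integral, defined by integration
by parts. -/
noncomputable def expStieltjes (c : ℝ) (w : ℝ → ℝ) (s : ℝ) : ℝ :=
  Real.exp (c * s) * w s - w 0 - ∫ u in (0 : ℝ)..s, c * Real.exp (c * u) * w u

/-- The Riemann–Stieltjes sum of `exp (c u)` against `w` stopped at `s`, on the uniform grid with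
`m` cells of `[0, T]`. -/
noncomputable def expStieltjesSum (c : ℝ) (w : ℝ → ℝ) (T : ℝ) (m : ℕ) (s : ℝ) : ℝ :=
  ∑ k ∈ Finset.range m, Real.exp (c * (T * k / m)) *
    (w (min (T * (k + 1 : ℕ) / m) s) - w (min (T * k / m) s))

lemma hasDerivAt_exp_const_mul (c u : ℝ) :
    HasDerivAt (fun u ↦ Real.exp (c * u)) (c * Real.exp (c * u)) u := by
  simpa [mul_comm] using ((hasDerivAt_id u).const_mul c).exp

lemma integral_mul_exp (c a b : ℝ) :
    ∫ u in a..b, c * Real.exp (c * u) = Real.exp (c * b) - Real.exp (c * a) :=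
  intervalIntegral.integral_eq_sub_of_hasDerivAt (fun u _ ↦ hasDerivAt_exp_const_mul c u)
    (Continuous.intervalIntegrable (by fun_prop) _ _)

/-- Abel summation moves the increments from the path to the exponential, whose increments are
integrals of its derivative. The path is left sampled at the right end of each cell. -/
lemma expStieltjesSum_eq {c : ℝ} (w : ℝ → ℝ) {T s : ℝ} (h0 : 0 ≤ s) (hsT : s ≤ T)
    {m : ℕ} (hm : m ≠ 0) :
    expStieltjesSum c w T m s = Real.exp (c * T) * w s - w 0 -
      ∑ k ∈ Finset.range m, ∫ u in (T * k / m)..(T * (k + 1 : ℕ) / m),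
        c * Real.exp (c * u) * w (min (T * (k + 1 : ℕ) / m) s) := by
  have hm' : (m : ℝ) ≠ 0 := by exact_mod_cast hm
  simp_rw [intervalIntegral.integral_mul_const, integral_mul_exp]
  have key := Finset.sum_range_sub
    (fun k : ℕ ↦ Real.exp (c * (T * k / m)) * w (min (T * k / m) s)) m
  have e1 : T * (m : ℝ) / m = T := by field_simp
  simp only [e1, min_eq_right hsT, Nat.cast_zero, mul_zero, zero_div, Real.exp_zero, one_mul,
    min_eq_left h0] at key
  rw [← key, ← Finset.sum_sub_distrib]
  exact Finset.sum_congr rfl fun k _ ↦ by ring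

/-- On $[s,T]$ the stopped path is constant, so extending the integral to $T$ is offset by replacing
$e^{cs}$ with $e^{cT}$ in the boundary term. This is the continuous counterpart of
`expStieltjesSum_eq`. -/
lemma expStieltjes_eq {c : ℝ} {w : ℝ → ℝ} (hw : Continuous w) {T s : ℝ} (h0 : 0 ≤ s)
    (hsT : s ≤ T) :
    expStieltjes c w s = Real.exp (c * T) * w s - w 0 -
      ∫ u in (0 : ℝ)..T, c * Real.exp (c * u) * w (min u s) := by
  have hi (a b : ℝ) : IntervalIntegrable (fun u ↦ c * Real.exp (c * u) * w (min u s)) volume a b :=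
    Continuous.intervalIntegrable (by fun_prop) _ _
  rw [← intervalIntegral.integral_add_adjacent_intervals (hi 0 s) (hi s T)]
  have h1 : ∫ u in (0 : ℝ)..s, c * Real.exp (c * u) * w (min u s) =
      ∫ u in (0 : ℝ)..s, c * Real.exp (c * u) * w u := by
    refine intervalIntegral.integral_congr fun u hu ↦ ?_
    rw [uIcc_of_le h0] at hu
    simp [min_eq_left hu.2]
  have h2 : ∫ u in s..T, c * Real.exp (c * u) * w (min u s) =
      ∫ u in s..T, c * Real.exp (c * u) * w s := by
    refine intervalIntegral.integral_congr fun u hu ↦ ?_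
    rw [uIcc_of_le hsT] at hu
    simp [min_eq_right hu.1]
  rw [h1, h2, intervalIntegral.integral_mul_const, integral_mul_exp, expStieltjes]
  ring

/-- Convergence of Riemann sums, with the factor `f` sampled at the right end of each cell. -/
lemma tendsto_sum_integral_sample_right {f g : ℝ → ℝ} (hf : Continuous f) (hg : Continuous g)
    {T : ℝ} (hT : 0 ≤ T) :
    Tendsto (fun m : ℕ ↦ ∑ k ∈ Finset.range m, ∫ u in (T * k / m)..(T * (k + 1 : ℕ) / m),
      g u * f (T * (k + 1 : ℕ) / m)) atTop (𝓝 (∫ u in (0 : ℝ)..T, g u * f u)) := by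
  set B := ∫ u in (0 : ℝ)..T, |g u| with hB
  have hB0 : 0 ≤ B := intervalIntegral.integral_nonneg hT fun _ _ ↦ abs_nonneg _
  rw [Metric.tendsto_atTop]
  intro ε hε
  have huc := isCompact_Icc.uniformContinuousOn_of_continuous
    (hf.continuousOn (s := Icc 0 T))
  rw [Metric.uniformContinuousOn_iff] at huc
  -- The total error is at most $\varepsilon B/(B+1)<\varepsilon$; adding 1 covers $B=0$.
  obtain ⟨δ, hδ, hfδ⟩ := huc (ε / (B + 1)) (by positivity)
  obtain ⟨m₀, hm₀⟩ := exists_nat_gt (T / δ)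
  refine ⟨m₀ + 1, fun m hm ↦ ?_⟩
  have hmpos : (0 : ℝ) < m := by
    have : 0 < m := by omega
    exact_mod_cast this
  have hmesh : T / m < δ := by
    rw [div_lt_iff₀ hmpos]
    rw [div_lt_iff₀ hδ] at hm₀
    have : (m₀ : ℝ) < m := by exact_mod_cast hm
    nlinarith
  have hstep (k : ℕ) : T * k / m ≤ T * (k + 1 : ℕ) / m := by
    push_cast
    gcongr
    linarith
  have hlen (k : ℕ) : T * (k + 1 : ℕ) / m - T * k / m = T / m := by
    push_cast
    ring
  have hend (k : ℕ) (hk : k < m) : T * (k + 1 : ℕ) / m ≤ T := by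
    rw [div_le_iff₀ hmpos]
    have : ((k + 1 : ℕ) : ℝ) ≤ m := by exact_mod_cast hk
    gcongr
  have hstart (k : ℕ) : 0 ≤ T * (k : ℝ) / m := by positivity
  have hsplit (h : ℝ → ℝ) (hh : Continuous h) :
      ∫ u in (0 : ℝ)..T, h u =
        ∑ k ∈ Finset.range m, ∫ u in (T * k / m)..(T * (k + 1 : ℕ) / m), h u := by
    rw [intervalIntegral.sum_integral_adjacent_intervals (a := fun k : ℕ ↦ T * (k : ℝ) / m)
      fun k _ ↦ hh.intervalIntegrable _ _]
    congr 1
    · simp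
    · field_simp
  rw [hsplit (fun u ↦ g u * f u) (hg.mul hf), dist_eq_norm, ← Finset.sum_sub_distrib]
  have hcell (k : ℕ) (hk : k ∈ Finset.range m) :
      ‖(∫ u in (T * k / m)..(T * (k + 1 : ℕ) / m), g u * f (T * (k + 1 : ℕ) / m)) -
        ∫ u in (T * k / m)..(T * (k + 1 : ℕ) / m), g u * f u‖ ≤
      ∫ u in (T * k / m)..(T * (k + 1 : ℕ) / m), ε / (B + 1) * |g u| := by
    rw [← intervalIntegral.integral_sub (Continuous.intervalIntegrable (by fun_prop) _ _)
      (Continuous.intervalIntegrable (by fun_prop) _ _)]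
    refine intervalIntegral.norm_integral_le_of_norm_le (hstep k) (.of_forall fun u hu ↦ ?_)
      (Continuous.intervalIntegrable (by fun_prop) _ _)
    have hk' := Finset.mem_range.1 hk
    have hd : dist (f (T * (k + 1 : ℕ) / m)) (f u) < ε / (B + 1) := by
      refine hfδ _ ⟨hstart _, hend k hk'⟩ _ ⟨(hstart k).trans hu.1.le, hu.2.trans (hend k hk')⟩ ?_
      rw [Real.dist_eq, abs_of_nonneg (sub_nonneg.2 hu.2)]
      linarith [hlen k, hu.1]
    rw [← mul_sub, norm_mul, Real.norm_eq_abs, mul_comm, ← dist_eq_norm]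
    gcongr
  calc _ ≤ ∑ k ∈ Finset.range m,
        ∫ u in (T * k / m)..(T * (k + 1 : ℕ) / m), ε / (B + 1) * |g u| :=
        norm_sum_le_of_le _ hcell
    _ = ε / (B + 1) * B := by
        rw [← hsplit (fun u ↦ ε / (B + 1) * |g u|) (by fun_prop),
          intervalIntegral.integral_const_mul]
    _ < ε := by
        rw [div_mul_eq_mul_div, div_lt_iff₀ (by linarith)]
        nlinarith

/-- The Riemann–Stieltjes sums converge to the integral. -/
lemma tendsto_expStieltjesSum (c : ℝ) {w : ℝ → ℝ} (hw : Continuous w) {T s : ℝ} (h0 : 0 ≤ s)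
    (hsT : s ≤ T) :
    Tendsto (fun m ↦ expStieltjesSum c w T m s) atTop (𝓝 (expStieltjes c w s)) := by
  rw [expStieltjes_eq hw h0 hsT]
  have h := tendsto_sum_integral_sample_right (f := fun u ↦ w (min u s))
    (g := fun u ↦ c * Real.exp (c * u)) (by fun_prop) (by fun_prop) (h0.trans hsT)
  refine (h.const_sub (Real.exp (c * T) * w s - w 0)).congr' ?_
  filter_upwards [eventually_ne_atTop 0] with m hm
  rw [expStieltjesSum_eq w h0 hsT hm]

/-- Integrating against $du$ gives the limit of the covariances of the Wiener sums, by the Itô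
isometry, with $2c$ in place of $c$. -/
lemma expStieltjes_id {c : ℝ} (hc : c ≠ 0) (s : ℝ) :
    expStieltjes c (fun u ↦ u) s = (Real.exp (c * s) - 1) / c := by
  have h : ∫ u in (0 : ℝ)..s, c * Real.exp (c * u) * u =
      (Real.exp (c * s) * s - Real.exp (c * s) / c) -
        (Real.exp (c * 0) * 0 - Real.exp (c * 0) / c) := by
    refine intervalIntegral.integral_eq_sub_of_hasDerivAt
      (f := fun u ↦ Real.exp (c * u) * u - Real.exp (c * u) / c) (fun u _ ↦ ?_)
      (Continuous.intervalIntegrable (by fun_prop) _ _)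
    convert! ((hasDerivAt_exp_const_mul c u).mul (hasDerivAt_id u)).sub
      ((hasDerivAt_exp_const_mul c u).div_const c) using 1
    simp
    field_simp
    ring
  rw [expStieltjes, h]
  simp
  field_simp
  ring

/-- Variation of constants for `dx = κ (θ - x) ds + σ dw`. -/
lemma eq_of_integral_equation {κ θ σ x₀ : ℝ} {x w : ℝ → ℝ} (hx : Continuous x) (hw : Continuous w)
    (h : ∀ s, 0 ≤ s → x s = x₀ + (∫ u in (0 : ℝ)..s, κ * (θ - x u)) + σ * w s) {s : ℝ}
    (hs : 0 ≤ s) (hx0 : x 0 = x₀) :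
    x s = θ + (x₀ - θ) * Real.exp (-κ * s) + σ * Real.exp (-κ * s) * expStieltjes κ w s := by
  -- On $[0,\infty)$ this is $x-\sigma w$, which is differentiable although $w$ is not; $e^{\kappa
  -- u}z(u)$ then has derivative $\kappa e^{\kappa u}(\theta-\sigma w(u))$ there.
  set z : ℝ → ℝ := fun s ↦ x₀ + ∫ u in (0 : ℝ)..s, κ * (θ - x u) with hz
  have hzd (u : ℝ) : HasDerivAt z (κ * (θ - x u)) u :=
    (intervalIntegral.integral_hasDerivAt_right (Continuous.intervalIntegrable (by fun_prop) _ _)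
      (Continuous.stronglyMeasurableAtFilter (by fun_prop) _ _)
      (Continuous.continuousAt (by fun_prop))).const_add x₀
  have hzc : Continuous z := continuous_iff_continuousAt.2 fun u ↦ (hzd u).continuousAt
  have hw0 : σ * w 0 = 0 := by
    have := h 0 le_rfl
    simp [hx0] at this
    simpa using this
  have hftc : ∫ u in (0 : ℝ)..s, κ * Real.exp (κ * u) * (θ - σ * w u) =
      Real.exp (κ * s) * z s - Real.exp (κ * 0) * z 0 := by
    refine intervalIntegral.integral_eq_sub_of_hasDerivAt
      (f := fun u ↦ Real.exp (κ * u) * z u) (fun u hu ↦ ?_)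
      (Continuous.intervalIntegrable (by fun_prop) _ _)
    rw [uIcc_of_le hs] at hu
    convert! (hasDerivAt_exp_const_mul κ u).mul (hzd u) using 1
    have := h u hu.1
    simp only [hz]
    rw [this]
    ring
  have hsub : ∫ u in (0 : ℝ)..s, κ * Real.exp (κ * u) * (θ - σ * w u) =
      θ * (Real.exp (κ * s) - 1) - σ * ∫ u in (0 : ℝ)..s, κ * Real.exp (κ * u) * w u := by
    have : (fun u ↦ κ * Real.exp (κ * u) * (θ - σ * w u)) =
        fun u ↦ θ * (κ * Real.exp (κ * u)) - σ * (κ * Real.exp (κ * u) * w u) := by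
      ext u; ring
    rw [this, intervalIntegral.integral_sub (Continuous.intervalIntegrable (by fun_prop) _ _)
      (Continuous.intervalIntegrable (by fun_prop) _ _), intervalIntegral.integral_const_mul θ,
      intervalIntegral.integral_const_mul σ, integral_mul_exp]
    simp
  have hz0 : z 0 = x₀ := by simp [hz]
  have hxs : x s = z s + σ * w s := h s hs
  have he : Real.exp (-κ * s) * Real.exp (κ * s) = 1 := by
    rw [← Real.exp_add]; simp
  rw [hsub, hz0, mul_zero, Real.exp_zero, one_mul] at hftc
  rw [hxs, expStieltjes]
  linear_combination (θ - σ * w s - z s) * he + Real.exp (-κ * s) * hw0 - Real.exp (-κ * s) * hftc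

end NoisyOU

namespace NoisyOU

/-! ### Almost sure limits of Gaussian vectors -/

section GaussianLimit

open Filter Topology
open scoped Matrix RealInnerProductSpace

variable {Ω : Type*} {mΩ : MeasurableSpace Ω} {P : Measure Ω}

lemma covariance_congr_ae {U V U' V' : Ω → ℝ} (hU : U =ᵐ[P] U') (hV : V =ᵐ[P] V') :
    cov[U, V; P] = cov[U', V'; P] := by
  rw [covariance, covariance, integral_congr_ae hU, integral_congr_ae hV]
  refine integral_congr_ae ?_
  filter_upwards [hU, hV] with ω h1 h2
  rw [h1, h2]

lemma hasGaussianLaw_const_add {E : Type*} [NormedAddCommGroup E] [NormedSpace ℝ E]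
    [MeasurableSpace E] [BorelSpace E] [SecondCountableTopology E] {V : Ω → E}
    (hV : HasGaussianLaw V P) (c : E) : HasGaussianLaw (fun ω ↦ c + V ω) P where
  isGaussian_map := by
    have := hV.isGaussian_map
    have h : P.map (fun ω ↦ c + V ω) = (P.map V).map (c + ·) :=
      (AEMeasurable.map_map_of_aemeasurable (by fun_prop) hV.aemeasurable).symm
    rw [h]
    infer_instance

variable {ι : Type*} [Fintype ι]

/-- The variance of a linear combination as a quadratic form in the covariance matrix. -/
lemma variance_sum_mul [IsFiniteMeasure P] {V : ι → Ω → ℝ} (hV : ∀ i, MemLp (V i) 2 P)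
    (c : ι → ℝ) :
    Var[fun ω ↦ ∑ i, c i * V i ω; P] = c ⬝ᵥ covMatrix V P *ᵥ c := by
  rw [variance_fun_sum (X := fun i ω ↦ c i * V i ω) fun i ↦ (hV i).const_mul _]
  simp only [dotProduct, Matrix.mulVec, covMatrix, Matrix.of_apply, Finset.mul_sum]
  refine Finset.sum_congr rfl fun i _ ↦ Finset.sum_congr rfl fun j _ ↦ ?_
  rw [covariance_const_mul_left, covariance_const_mul_right]
  ring

lemma posSemidef_covMatrix [IsFiniteMeasure P] {V : ι → Ω → ℝ} (hV : ∀ i, MemLp (V i) 2 P) :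
    (covMatrix V P).PosSemidef := by
  refine .of_dotProduct_mulVec_nonneg ?_ fun c ↦ ?_
  · ext i j
    simp [covMatrix, covariance_comm]
  · rw [star_trivial, ← variance_sum_mul hV]
    exact variance_nonneg _ _

variable [DecidableEq ι]

/-- The almost sure limit of centred Gaussian vectors whose covariance matrices converge is a
Gaussian vector, with the limit covariance matrix. -/
theorem hasLaw_multivariateGaussian_of_tendsto [IsProbabilityMeasure P] {V : ℕ → ι → Ω → ℝ}
    {U : ι → Ω → ℝ} {K : Matrix ι ι ℝ} (hV : ∀ m, HasGaussianLaw (fun ω i ↦ V m i ω) P)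
    (h0 : ∀ m i, ∫ ω, V m i ω ∂P = 0)
    (hK : ∀ i j, Tendsto (fun m ↦ cov[V m i, V m j; P]) atTop (𝓝 (K i j)))
    (hlim : ∀ i, ∀ᵐ ω ∂P, Tendsto (fun m ↦ V m i ω) atTop (𝓝 (U i ω))) :
    K.PosSemidef ∧ HasLaw (fun ω ↦ WithLp.toLp 2 fun i ↦ U i ω) (multivariateGaussian 0 K) P := by
  have hLp (m : ℕ) (i : ι) : MemLp (V m i) 2 P := ((hV m).eval i).memLp_two
  have hKm : Tendsto (fun m ↦ covMatrix (V m) P) atTop (𝓝 K) :=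
    tendsto_pi_nhds.2 fun i ↦ tendsto_pi_nhds.2 fun j ↦ hK i j
  have hquad (c : ι → ℝ) :
      Tendsto (fun m ↦ c ⬝ᵥ covMatrix (V m) P *ᵥ c) atTop (𝓝 (c ⬝ᵥ K *ᵥ c)) := by
    have : Continuous fun S : Matrix ι ι ℝ ↦ c ⬝ᵥ S *ᵥ c := by fun_prop
    exact (this.tendsto K).comp hKm
  have hKpos : K.PosSemidef := by
    refine .of_dotProduct_mulVec_nonneg ?_ fun c ↦ ?_
    · ext i j
      rw [Matrix.conjTranspose_apply, star_trivial]
      refine tendsto_nhds_unique (hK j i) ?_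
      simpa only [covariance_comm] using hK i j
    · rw [star_trivial]
      refine ge_of_tendsto' (hquad c) fun m ↦ ?_
      simpa using (posSemidef_covMatrix (hLp m)).dotProduct_mulVec_nonneg c
  have hUm : AEMeasurable (fun ω ↦ WithLp.toLp 2 fun i ↦ U i ω) P := by
    refine (WithLp.measurable_toLp 2 (ι → ℝ)).comp_aemeasurable (aemeasurable_pi_lambda _ fun i ↦ ?_)
    exact aemeasurable_of_tendsto_metrizable_ae atTop (fun m ↦ (hLp m i).aemeasurable) (hlim i)
  refine ⟨hKpos, hUm, ?_⟩
  have := Measure.isProbabilityMeasure_map (μ := P) hUm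
  -- The characteristic functions of the approximations have two limits: that of $U$ by dominated
  -- convergence, and the Gaussian one because their quadratic forms converge. Degenerate $K$ is
  -- allowed.
  refine Measure.ext_of_charFun (funext fun t ↦ ?_)
  rw [charFun_multivariateGaussian hKpos]
  have hVm (m : ℕ) : HasGaussianLaw (fun ω ↦ WithLp.toLp 2 fun i ↦ V m i ω) P := (hV m).toLp_pi 2
  have hinner (m : ℕ) : (fun ω ↦ ⟪t, WithLp.toLp 2 fun i ↦ V m i ω⟫) =
      fun ω ↦ ∑ i, t i * V m i ω := by
    ext ω
    simp [PiLp.inner_apply, mul_comm]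
  have hchar (m : ℕ) : charFun (P.map fun ω ↦ WithLp.toLp 2 fun i ↦ V m i ω) t =
      Complex.exp (-((t ⬝ᵥ covMatrix (V m) P *ᵥ t : ℝ) : ℂ) / 2) := by
    rw [(hVm m).charFun_map_eq, hinner, variance_sum_mul (hLp m),
      integral_finsetSum _ fun i _ ↦ ((hLp m i).integrable (by norm_num)).const_mul _]
    simp [integral_const_mul, h0, neg_div]
  have hl1 : Tendsto (fun m ↦ charFun (P.map fun ω ↦ WithLp.toLp 2 fun i ↦ V m i ω) t) atTop
      (𝓝 (charFun (P.map fun ω ↦ WithLp.toLp 2 fun i ↦ U i ω) t)) := by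
    simp_rw [charFun_apply]
    rw [integral_map hUm (by fun_prop)]
    simp_rw [fun m ↦ integral_map (hVm m).aemeasurable (f := fun x ↦ Complex.exp (⟪x, t⟫ * Complex.I))
      (by fun_prop)]
    refine tendsto_integral_of_dominated_convergence (fun _ ↦ 1) (fun m ↦ ?_) (by simp)
      (fun m ↦ .of_forall fun ω ↦ by rw [Complex.norm_exp_ofReal_mul_I]) ?_
    · have := (hVm m).aemeasurable
      refine AEMeasurable.aestronglyMeasurable ?_
      fun_prop
    · filter_upwards [ae_all_iff.2 hlim] with ω hω
      have h1 : Tendsto (fun m ↦ WithLp.toLp 2 fun i ↦ V m i ω) atTop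
          (𝓝 (WithLp.toLp 2 fun i ↦ U i ω)) :=
        ((PiLp.continuous_toLp 2 _).tendsto _).comp (tendsto_pi_nhds.2 hω)
      have h2 : Continuous fun x : EuclideanSpace ℝ ι ↦ Complex.exp (⟪x, t⟫ * Complex.I) := by
        fun_prop
      exact (h2.tendsto _).comp h1
  have hl2 : Tendsto (fun m ↦ charFun (P.map fun ω ↦ WithLp.toLp 2 fun i ↦ V m i ω) t) atTop
      (𝓝 (Complex.exp (-((t ⬝ᵥ K *ᵥ t : ℝ) : ℂ) / 2))) := by
    simp_rw [hchar]
    have : Continuous fun r : ℝ ↦ Complex.exp (-(r : ℂ) / 2) := by fun_prop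
    exact (this.tendsto _).comp (hquad t)
  rw [tendsto_nhds_unique hl1 hl2]
  simp [neg_div]

end GaussianLimit

/-! ### The Wiener integral of an exponential -/

section WienerIntegral

open Filter Topology

variable {Ω : Type*} {mΩ : MeasurableSpace Ω} {P : Measure Ω} {W : ℝ≥0 → Ω → ℝ}

/-- Increments over successive cells stay uncorrelated when stopped at different times: since $a\le
b\le c\le d$, the covariances with $W_{d\wedge t}$ and $W_{c\wedge t}$ agree and cancel. -/
lemma covariance_stopped_increment (hW : IsPreBrownianReal W P) {a b c d : ℝ≥0}
    (hab : a ≤ b) (hbc : b ≤ c) (hcd : c ≤ d) (s t : ℝ≥0) :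
    cov[fun ω ↦ W (min b s) ω - W (min a s) ω, fun ω ↦ W (min d t) ω - W (min c t) ω; P] = 0 := by
  have := hW.isGaussianProcess.isProbabilityMeasure
  have hLp (r : ℝ≥0) : MemLp (W r) 2 P := (hW.isGaussianProcess.hasGaussianLaw_eval r).memLp_two
  rw [covariance_fun_sub_fun_sub (hLp _) (hLp _) (hLp _) (hLp _)]
  simp only [hW.covariance_eval]
  rw [min_min_min_comm b s d t, min_min_min_comm b s c t, min_min_min_comm a s d t,
    min_min_min_comm a s c t, min_eq_left (hbc.trans hcd), min_eq_left hbc, min_eq_left (hab.trans (hbc.trans hcd)),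
    min_eq_left (hab.trans hbc)]
  ring

lemma covariance_stopped_increment_self (hW : IsPreBrownianReal W P) {a b : ℝ≥0} (hab : a ≤ b)
    (s t : ℝ≥0) :
    cov[fun ω ↦ W (min b s) ω - W (min a s) ω, fun ω ↦ W (min b t) ω - W (min a t) ω; P] =
      (min b (min s t) : ℝ≥0) - (min a (min s t) : ℝ≥0) := by
  have := hW.isGaussianProcess.isProbabilityMeasure
  have hLp (r : ℝ≥0) : MemLp (W r) 2 P := (hW.isGaussianProcess.hasGaussianLaw_eval r).memLp_two
  rw [covariance_fun_sub_fun_sub (hLp _) (hLp _) (hLp _) (hLp _)]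
  simp only [hW.covariance_eval]
  rw [min_min_min_comm b s b t, min_min_min_comm b s a t, min_min_min_comm a s b t,
    min_min_min_comm a s a t, min_eq_right hab, min_eq_left hab, min_self, min_self]
  ring

/-- The Riemann–Stieltjes sums of `exp (c u)` against `W`, as linear combinations of values
of `W`. -/
noncomputable def wienerSum (c : ℝ) (W : ℝ≥0 → Ω → ℝ) (T : ℝ≥0) (m : ℕ) (s : ℝ≥0) (ω : Ω) : ℝ :=
  ∑ k ∈ Finset.range m, Real.exp (c * (T * k / m)) *
    (W (min (T * (k + 1 : ℕ) / m) s) ω - W (min (T * k / m) s) ω)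

lemma wienerSum_eq (c : ℝ) (W : ℝ≥0 → Ω → ℝ) (T : ℝ≥0) (m : ℕ) (s : ℝ≥0) (ω : Ω) :
    wienerSum c W T m s ω = expStieltjesSum c (fun u ↦ W u.toNNReal ω) T m s := by
  have h (k : ℕ) : Real.toNNReal (min ((T : ℝ) * k / m) s) = min (T * k / m) s := by
    rw [← Real.toNNReal_coe (r := min (T * k / m) s)]
    push_cast
    rfl
  simp only [wienerSum, expStieltjesSum, h]

lemma isGaussianProcess_wienerSum (hW : IsPreBrownianReal W P) (c : ℝ) (T : ℝ≥0) (m : ℕ) :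
    IsGaussianProcess (wienerSum c W T m) P := by
  classical
  refine hW.isGaussianProcess.of_isGaussianProcess fun s ↦ ?_
  let I : Finset ℝ≥0 := (Finset.range (m + 1)).image fun k : ℕ ↦ min (T * k / m) s
  have hI {k : ℕ} (hk : k ≤ m) : min (T * k / m) s ∈ I :=
    Finset.mem_image_of_mem _ (Finset.mem_range.2 (by omega))
  let L : (I → ℝ) →L[ℝ] ℝ := ∑ k : Fin m, Real.exp (c * (T * (k : ℕ) / m)) •
    (ContinuousLinearMap.proj (R := ℝ) (φ := fun _ : I ↦ ℝ) ⟨_, hI (k := k + 1) k.2⟩ -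
      ContinuousLinearMap.proj (R := ℝ) (φ := fun _ : I ↦ ℝ) ⟨_, hI (k := k) k.2.le⟩)
  refine ⟨I, L, fun ω ↦ ?_⟩
  simp [L, wienerSum, Finset.sum_range]

lemma integral_wienerSum (hW : IsPreBrownianReal W P) (c : ℝ) (T : ℝ≥0) (m : ℕ) (s : ℝ≥0) :
    ∫ ω, wienerSum c W T m s ω ∂P = 0 := by
  have hi (a b : ℝ≥0) : Integrable (fun ω ↦ W a ω - W b ω) P :=
    (hW.integrable_eval a).sub (hW.integrable_eval b)
  unfold wienerSum
  rw [integral_finsetSum _ fun k _ ↦ (hi _ _).const_mul _]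
  refine Finset.sum_eq_zero fun k _ ↦ ?_
  rw [integral_const_mul, integral_sub (hW.integrable_eval _) (hW.integrable_eval _),
    hW.integral_eval, hW.integral_eval, sub_zero, mul_zero]

/-- A discrete Itô isometry: only equal cells contribute, each with squared weight $e^{2cu}$ at its
left end $u$ and the length of the cell stopped at $\min(s,t)$. The result is again a Stieltjes sum,
so `tendsto_expStieltjesSum` also gives the limit of the covariances. -/
lemma covariance_wienerSum (hW : IsPreBrownianReal W P) (c : ℝ) (T : ℝ≥0) (m : ℕ) (s t : ℝ≥0) :
    cov[wienerSum c W T m s, wienerSum c W T m t; P] =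
      expStieltjesSum (2 * c) (fun u ↦ u) T m (min s t : ℝ≥0) := by
  have := hW.isGaussianProcess.isProbabilityMeasure
  have hLp (r : ℝ≥0) : MemLp (W r) 2 P := (hW.isGaussianProcess.hasGaussianLaw_eval r).memLp_two
  have hgrid : Monotone fun k : ℕ ↦ T * (k : ℝ≥0) / m := fun k l hkl ↦ by
    have : (k : ℝ≥0) ≤ l := by exact_mod_cast hkl
    dsimp only
    gcongr
  have hLp' (a b : ℝ≥0) : MemLp (fun ω ↦ W a ω - W b ω) 2 P := (hLp a).sub (hLp b)
  unfold wienerSum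
  rw [covariance_fun_sum_fun_sum' (fun k _ ↦ (hLp' _ _).const_mul _)
    (fun k _ ↦ (hLp' _ _).const_mul _), expStieltjesSum]
  refine Finset.sum_congr rfl fun k hk ↦ ?_
  rw [Finset.sum_eq_single_of_mem k hk]
  · rw [covariance_const_mul_left, covariance_const_mul_right,
      covariance_stopped_increment_self hW (hgrid k.le_succ), ← mul_assoc, ← Real.exp_add]
    push_cast
    ring_nf
  · intro l _ hlk
    rw [covariance_const_mul_left, covariance_const_mul_right]
    rcases lt_or_gt_of_ne hlk with h | h
    · rw [covariance_comm, covariance_stopped_increment hW (hgrid l.le_succ) (hgrid h)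
        (hgrid k.le_succ)]
      simp
    · rw [covariance_stopped_increment hW (hgrid k.le_succ) (hgrid h) (hgrid l.le_succ)]
      simp

/-- The Wiener integral `∫₀ˢ exp (c u) dW(u)`. -/
noncomputable def wienerExp (c : ℝ) (W : ℝ≥0 → Ω → ℝ) (s : ℝ≥0) (ω : Ω) : ℝ :=
  expStieltjes c (fun u ↦ W u.toNNReal ω) s

lemma tendsto_wienerSum (hW : IsBrownianReal W P) (c : ℝ) {T s : ℝ≥0} (hs : s ≤ T) :
    ∀ᵐ ω ∂P, Tendsto (fun m ↦ wienerSum c W T m s ω) atTop (𝓝 (wienerExp c W s ω)) := by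
  filter_upwards [hW.cont] with ω hω
  simp_rw [wienerSum_eq]
  exact tendsto_expStieltjesSum c (hω.comp continuous_real_toNNReal) s.2 hs

/-- Finite-dimensional laws of the Wiener integrals of `exp (c u)`. -/
theorem hasLaw_wienerExp (hW : IsBrownianReal W P) {c : ℝ} (hc : c ≠ 0)
    {ι : Type*} [Fintype ι] [DecidableEq ι] (τ : ι → ℝ≥0) :
    (Matrix.of fun i j ↦ (Real.exp (2 * c * (min (τ i) (τ j) : ℝ≥0)) - 1) / (2 * c)).PosSemidef ∧
    HasLaw (fun ω ↦ WithLp.toLp 2 fun i ↦ wienerExp c W (τ i) ω)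
      (multivariateGaussian 0
        (Matrix.of fun i j ↦ (Real.exp (2 * c * (min (τ i) (τ j) : ℝ≥0)) - 1) / (2 * c))) P := by
  have := hW.toIsPreBrownianReal.isGaussianProcess.isProbabilityMeasure
  -- One horizon, hence one grid, serves all the times; `covariance_wienerSum` needs both sums on
  -- the same grid.
  set T := Finset.univ.sup τ with hT
  have hτ (i : ι) : τ i ≤ T := Finset.le_sup (Finset.mem_univ i)
  refine hasLaw_multivariateGaussian_of_tendsto
    (V := fun m i ↦ wienerSum c W T m (τ i)) (fun m ↦ ?_)
    (fun m i ↦ integral_wienerSum hW.toIsPreBrownianReal _ _ _ _) (fun i j ↦ ?_)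
    fun i ↦ tendsto_wienerSum hW c (hτ i)
  · have h := (isGaussianProcess_wienerSum hW.toIsPreBrownianReal c T m).hasGaussianLaw
      (Finset.univ.image τ)
    exact h.map_fun (ContinuousLinearMap.pi fun i ↦ ContinuousLinearMap.proj (R := ℝ)
      (φ := fun _ : Finset.univ.image τ ↦ ℝ) ⟨τ i, by simp⟩)
  · simp_rw [covariance_wienerSum hW.toIsPreBrownianReal, Matrix.of_apply]
    rw [← expStieltjes_id (by simpa using hc)]
    exact tendsto_expStieltjesSum _ continuous_id (min (τ i) (τ j)).2
      (by exact_mod_cast min_le_of_left_le (hτ i))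

theorem isGaussianProcess_wienerExp (hW : IsBrownianReal W P) {c : ℝ} (hc : c ≠ 0) :
    IsGaussianProcess (wienerExp c W) P where
  hasGaussianLaw I := by
    classical
    exact (hasLaw_wienerExp hW hc (fun i : I ↦ (i : ℝ≥0))).2.hasGaussianLaw.map_equiv
      (PiLp.continuousLinearEquiv 2 ℝ fun _ : I ↦ ℝ)

theorem covariance_wienerExp (hW : IsBrownianReal W P) {c : ℝ} (hc : c ≠ 0) (s t : ℝ≥0) :
    cov[wienerExp c W s, wienerExp c W t; P] =
      (Real.exp (2 * c * (min s t : ℝ≥0)) - 1) / (2 * c) := by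
  obtain ⟨hK, h⟩ := hasLaw_wienerExp hW hc ![s, t]
  have := h.covariance_fun_comp (f := fun x ↦ x 0) (g := fun x ↦ x 1) (by fun_prop) (by fun_prop)
  rw [covariance_eval_multivariateGaussian hK] at this
  simpa using this

end WienerIntegral

/-! ### Gaussianity and covariance of the Ornstein–Uhlenbeck process -/

section OrnsteinUhlenbeck

variable {Ω : Type*} {mΩ : MeasurableSpace Ω} {P : Measure Ω} {κ θ σ x₀ : ℝ}
  {X W : ℝ≥0 → Ω → ℝ}

lemma IsOrnsteinUhlenbeck.ae_eq (hX : IsOrnsteinUhlenbeck κ θ σ x₀ X W P) (s : ℝ≥0) :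
    X s =ᵐ[P] fun ω ↦ θ + (x₀ - θ) * Real.exp (-κ * s) +
      σ * Real.exp (-κ * s) * wienerExp κ W s ω := by
  filter_upwards [hX.continuous_paths, hX.initial, hX.equation, hX.isBrownian.cont]
    with ω hc h0 he hw
  have := eq_of_integral_equation (x := fun u ↦ X u.toNNReal ω) (w := fun u ↦ W u.toNNReal ω)
    (x₀ := x₀) (κ := κ) (θ := θ) (σ := σ) (hc.comp continuous_real_toNNReal)
    (hw.comp continuous_real_toNNReal) (fun u hu ↦ ?_) s.2 (by simpa using h0)
  · simpa [wienerExp] using this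
  · have := he u.toNNReal
    rwa [Real.coe_toNNReal _ hu, h0] at this

theorem IsOrnsteinUhlenbeck.isGaussianProcess (hκ : κ ≠ 0)
    (hX : IsOrnsteinUhlenbeck κ θ σ x₀ X W P) : IsGaussianProcess X P where
  hasGaussianLaw I := by
    have h := ((isGaussianProcess_wienerExp hX.isBrownian hκ).smul
      fun s : ℝ≥0 ↦ σ * Real.exp (-κ * s)).hasGaussianLaw I
    refine (hasGaussianLaw_const_add h fun s : I ↦ θ + (x₀ - θ) * Real.exp (-κ * s)).congr ?_
    filter_upwards [ae_all_iff.2 fun s : I ↦ hX.ae_eq s] with ω hω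
    ext s
    simp [hω s]

theorem IsOrnsteinUhlenbeck.covariance (hκ : κ ≠ 0) (hX : IsOrnsteinUhlenbeck κ θ σ x₀ X W P)
    (s t : ℝ≥0) :
    cov[X s, X t; P] = σ ^ 2 / (2 * κ) * Real.exp (-κ * s) * Real.exp (-κ * t) *
      (Real.exp (2 * κ * (min s t : ℝ≥0)) - 1) := by
  have hG := isGaussianProcess_wienerExp hX.isBrownian hκ
  have := hG.isProbabilityMeasure
  have hi (r : ℝ≥0) : Integrable (fun ω ↦ σ * Real.exp (-κ * r) * wienerExp κ W r ω) P :=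
    (hG.hasGaussianLaw_eval r).integrable.const_mul _
  rw [covariance_congr_ae (hX.ae_eq s) (hX.ae_eq t), covariance_const_add_left (hi s),
    covariance_const_add_right (hi t), covariance_const_mul_left, covariance_const_mul_right,
    covariance_wienerExp hX.isBrownian hκ]
  field_simp

end OrnsteinUhlenbeck

end NoisyOU

namespace NoisyOU

/-! ### Mutual information with an independent Gaussian residual -/

section MutualInformation

variable {Ω : Type*} {mΩ : MeasurableSpace Ω} {P : Measure Ω}

lemma lintegral_gaussianReal {m : ℝ} {v : ℝ≥0} (hv : v ≠ 0) {f : ℝ → ℝ≥0∞} (hf : Measurable f) :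
    ∫⁻ x, f x ∂gaussianReal m v = ∫⁻ x, gaussianPDF m v x * f x := by
  rw [gaussianReal_of_var_ne_zero _ hv,
    lintegral_withDensity_eq_lintegral_mul _ (measurable_gaussianPDF _ _) hf]
  rfl

lemma log_gaussianPDFReal_div {a m : ℝ} {v w : ℝ≥0} (hv : v ≠ 0) (hw : w ≠ 0) (x : ℝ) :
    Real.log (gaussianPDFReal a v x / gaussianPDFReal m w x) =
      1 / 2 * Real.log (w / v) - (x - a) ^ 2 / (2 * v) + (x - m) ^ 2 / (2 * w) := by
  have hv' : (0 : ℝ) < v := by positivity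
  have hw' : (0 : ℝ) < w := by positivity
  rw [Real.log_div (gaussianPDFReal_pos _ _ _ hv).ne' (gaussianPDFReal_pos _ _ _ hw).ne',
    gaussianPDFReal, gaussianPDFReal, Real.log_mul (by positivity) (by positivity),
    Real.log_mul (by positivity) (by positivity), Real.log_exp, Real.log_exp, Real.log_inv,
    Real.log_inv, Real.log_sqrt (by positivity), Real.log_sqrt (by positivity),
    Real.log_mul (by positivity) hv'.ne', Real.log_mul (by positivity) hw'.ne',
    Real.log_div hw'.ne' hv'.ne']
  ring

/-- The law of `(h V + R, V)` for Gaussian `R` independent of `V`, as a density with respect to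
a product measure with Gaussian first factor. -/
lemma map_prodMk_eq_withDensity {F : Type*} [MeasurableSpace F] [IsProbabilityMeasure P]
    {U R : Ω → ℝ} {V : Ω → F} {h : F → ℝ} (hh : Measurable h) (hV : AEMeasurable V P)
    {m a : ℝ} {v w : ℝ≥0} (hv : v ≠ 0) (hw : w ≠ 0)
    (hR : HasLaw R (gaussianReal a v) P) (hUR : ∀ᵐ ω ∂P, U ω = h (V ω) + R ω)
    (hRV : IndepFun R V P) :
    P.map (fun ω ↦ (U ω, V ω)) = ((gaussianReal m w).prod (P.map V)).withDensity
      fun p ↦ gaussianPDF (a + h p.2) v p.1 / gaussianPDF m w p.1 := by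
  have := Measure.isProbabilityMeasure_map (μ := P) hV
  have hmap : P.map (fun ω ↦ (U ω, V ω)) =
      ((gaussianReal a v).prod (P.map V)).map fun p ↦ (h p.2 + p.1, p.2) := by
    rw [← hR.map_eq, ← (indepFun_iff_map_prod_eq_prod_map_map hR.aemeasurable hV).1 hRV,
      AEMeasurable.map_map_of_aemeasurable (by fun_prop) (hR.aemeasurable.prodMk hV)]
    refine Measure.map_congr ?_
    filter_upwards [hUR] with ω hω
    simp [hω]
  have hg : Measurable fun p : ℝ × F ↦
      gaussianPDF (a + h p.2) v p.1 / gaussianPDF m w p.1 := by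
    fun_prop
  rw [hmap]
  refine Measure.ext_of_lintegral _ fun f hf ↦ ?_
  rw [lintegral_map hf (by fun_prop), lintegral_withDensity_eq_lintegral_mul _ hg hf,
    lintegral_prod_symm _ (by fun_prop), lintegral_prod_symm _ (hg.mul hf).aemeasurable]
  refine lintegral_congr fun y ↦ ?_
  rw [lintegral_gaussianReal hv (by fun_prop), lintegral_gaussianReal hw (by fun_prop)]
  -- Translation invariance of Lebesgue measure shifts the law of the residual to be centred at
  -- $a+h(y)$, for each fixed $y$.
  have key := lintegral_add_left_eq_self (μ := volume)
    (fun x : ℝ ↦ gaussianPDF (a + h y) v x * f (x, y)) (h y)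
  simp only [Pi.mul_apply] at key ⊢
  calc _ = ∫⁻ x, gaussianPDF (a + h y) v (h y + x) * f (h y + x, y) := by
        refine lintegral_congr fun x ↦ ?_
        simp [gaussianPDF, ← gaussianPDFReal_sub]
    _ = ∫⁻ x, gaussianPDF (a + h y) v x * f (x, y) := key
    _ = _ := by
        refine lintegral_congr fun x ↦ ?_
        rw [← mul_assoc, ENNReal.mul_div_cancel (gaussianPDF_pos _ hw _).ne' gaussianPDF_ne_top]

/-- If `U = h V + R` with `R` Gaussian and independent of `V`, and `U` is Gaussian, then the mutual
information of `U` and `V` is half the logarithm of the ratio of the variances of `U`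
and `R`. -/
theorem mutualInfo_eq_of_gaussian_residual {F : Type*} [MeasurableSpace F]
    [IsProbabilityMeasure P] {U R : Ω → ℝ} {V : Ω → F} {h : F → ℝ} (hh : Measurable h)
    (hV : AEMeasurable V P) (hU : HasGaussianLaw U P) (hR : HasGaussianLaw R P)
    (hUR : ∀ᵐ ω ∂P, U ω = h (V ω) + R ω) (hRV : IndepFun R V P)
    (hU0 : 0 < Var[U; P]) (hR0 : 0 < Var[R; P]) :
    mutualInfo U V P ≠ ∞ ∧
      (mutualInfo U V P).toReal = 1 / 2 * Real.log (Var[U; P] / Var[R; P]) := by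
  have := Measure.isProbabilityMeasure_map (μ := P) hV
  have := Measure.isProbabilityMeasure_map (μ := P) (hU.aemeasurable.prodMk hV)
  set v := Var[R; P].toNNReal with hv_def
  set w := Var[U; P].toNNReal with hw_def
  set a := P[R]
  set m := P[U]
  have hv : v ≠ 0 := by simpa [hv_def] using hR0
  have hw : w ≠ 0 := by simpa [hw_def] using hU0
  have hvc : (v : ℝ) = Var[R; P] := Real.coe_toNNReal _ hR0.le
  have hwc : (w : ℝ) = Var[U; P] := Real.coe_toNNReal _ hU0.le
  set g : ℝ × F → ℝ≥0∞ := fun p ↦ gaussianPDF (a + h p.2) v p.1 / gaussianPDF m w p.1 with hg_def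
  have hg : Measurable g := by fun_prop
  set ν := (gaussianReal m w).prod (P.map V)
  have hdens : P.map (fun ω ↦ (U ω, V ω)) = ν.withDensity g :=
    map_prodMk_eq_withDensity hh hV hv hw ⟨hR.aemeasurable, hR.map_eq_gaussianReal⟩ hUR hRV
  have hmi : mutualInfo U V P = klDiv (P.map fun ω ↦ (U ω, V ω)) ν := by
    rw [mutualInfo, hU.map_eq_gaussianReal]
  set μ := P.map (fun ω ↦ (U ω, V ω))
  have hac : μ ≪ ν := hdens ▸ withDensity_absolutelyContinuous _ _
  -- The log-likelihood ratio along $\omega$, where $U-(a+h(V))=R-a$. Each quadratic term has mean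
  -- $\frac12$, so the two cancel in expectation and only the logarithm remains.
  set ℓ : Ω → ℝ := fun ω ↦ 1 / 2 * Real.log (Var[U; P] / Var[R; P]) -
    (R ω - a) ^ 2 / (2 * Var[R; P]) + (U ω - m) ^ 2 / (2 * Var[U; P]) with hℓ
  have hllr : (fun ω ↦ llr μ ν (U ω, V ω)) =ᵐ[P] ℓ := by
    have h1 : ∀ᵐ p ∂μ, μ.rnDeriv ν p = g p := by
      refine hac.ae_le ?_
      rw [hdens]
      exact Measure.rnDeriv_withDensity ν hg
    filter_upwards [ae_of_ae_map (hU.aemeasurable.prodMk hV) h1, hUR] with ω h1 h2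
    rw [llr, h1, hg_def]
    simp only [ENNReal.toReal_div, toReal_gaussianPDF]
    rw [log_gaussianPDFReal_div hv hw, hvc, hwc, h2, hℓ]
    simp only [h2]
    ring
  have hRi : Integrable (fun ω ↦ (R ω - a) ^ 2) P := (hR.memLp_two.sub (memLp_const a)).integrable_sq
  have hUi : Integrable (fun ω ↦ (U ω - m) ^ 2) P := (hU.memLp_two.sub (memLp_const m)).integrable_sq
  have hi : Integrable (fun ω ↦ 1 / 2 * Real.log (Var[U; P] / Var[R; P]) -
      (R ω - a) ^ 2 / (2 * Var[R; P])) P := (integrable_const _).sub (hRi.div_const _)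
  have hℓi : Integrable ℓ P := hi.add (hUi.div_const _)
  have hllrm : AEStronglyMeasurable (llr μ ν) μ := (measurable_llr μ ν).aestronglyMeasurable
  have hint : Integrable (llr μ ν) μ :=
    (integrable_map_measure hllrm (hU.aemeasurable.prodMk hV)).2 (hℓi.congr hllr.symm)
  rw [hmi]
  refine ⟨klDiv_ne_top hac hint, ?_⟩
  rw [toReal_klDiv_of_measure_eq hac (by simp), integral_map (hU.aemeasurable.prodMk hV) hllrm,
    integral_congr_ae hllr, hℓ, integral_add hi (hUi.div_const _),
    integral_sub (integrable_const _) (hRi.div_const _), integral_div,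
    integral_div, ← variance_eq_integral hR.aemeasurable, ← variance_eq_integral hU.aemeasurable]
  simp
  field_simp
  ring

end MutualInformation

end NoisyOU

namespace NoisyOU

/-! ### The min kernel, Woodbury and Cramer -/

section MatrixLemmas

open scoped Matrix

/-- The kernel `min` is nondegenerate on strictly increasing positive numbers. -/
lemma isUnit_of_min {n : ℕ} {a : Fin (n + 1) → ℝ} (ha : StrictMono a) (ha0 : 0 < a 0) :
    IsUnit (Matrix.of fun i j ↦ min (a i) (a j)) := by
  rw [← Matrix.mulVec_injective_iff_isUnit, ← Matrix.coe_mulVecLin, injective_iff_map_eq_zero]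
  intro x hx
  have hrow (i : Fin (n + 1)) : ∑ j, min (a i) (a j) * x j = 0 := congrFun hx i
  -- Subtracting the previous row kills the columns before $i$ and leaves the constant
  -- $a_i-a_{i-1}>0$ from column $i$ on; the first row is already the constant $a_0$. Each entry
  -- $x_i$ is then a difference of two vanishing tails.
  have htail (i : Fin (n + 1)) : ∑ j ∈ Finset.Ici i, x j = 0 := by
    have hmul : ∃ d : ℝ, d ≠ 0 ∧ d * ∑ j ∈ Finset.Ici i, x j = 0 := by
      rcases Fin.eq_zero_or_eq_succ i with rfl | ⟨k, rfl⟩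
      · refine ⟨a 0, ha0.ne', ?_⟩
        rw [← hrow 0, Finset.mul_sum]
        refine Finset.sum_congr (by ext; simp) fun j _ ↦ ?_
        rw [min_eq_left (ha.monotone (Fin.zero_le j))]
      · refine ⟨a k.succ - a k.castSucc, (sub_pos.2 (ha k.castSucc_lt_succ)).ne', ?_⟩
        rw [← sub_zero (0 : ℝ)]
        nth_rewrite 1 [← hrow k.succ]
        rw [← hrow k.castSucc, ← Finset.sum_sub_distrib, Finset.mul_sum]
        rw [← Finset.sum_subset (Finset.subset_univ (Finset.Ici k.succ))]
        · refine Finset.sum_congr rfl fun j hj ↦ ?_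
          rw [Finset.mem_Ici] at hj
          rw [min_eq_left (ha.monotone hj),
            min_eq_left (ha.monotone ((Fin.castSucc_le_succ k).trans hj))]
          ring
        · intro j _ hj
          rw [Finset.mem_Ici, not_le, ← Fin.le_castSucc_iff] at hj
          rw [min_eq_right (ha.monotone hj),
            min_eq_right (ha.monotone (hj.trans (Fin.castSucc_le_succ k))), sub_self]
    obtain ⟨d, hd, h⟩ := hmul
    exact (mul_eq_zero.1 h).resolve_left hd
  ext i
  have h1 : ∑ j ∈ Finset.Ici i, x j = x i + ∑ j ∈ Finset.Ioi i, x j := by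
    rw [← Finset.Ioi_insert, Finset.sum_insert (by simp)]
  have h2 : ∑ j ∈ Finset.Ioi i, x j = 0 := by
    rcases Fin.eq_castSucc_or_eq_last i with ⟨k, rfl⟩ | rfl
    · rw [← htail k.succ]
      congr 1
      ext j
      simp [Fin.castSucc_lt_iff_succ_le]
    · refine Finset.sum_eq_zero fun j hj ↦ ?_
      exact absurd (Finset.mem_Ioi.1 hj) (not_lt.2 (Fin.le_last j))
  have := htail i
  rw [h1, h2, add_zero] at this
  simpa using this

/-- A case of the Woodbury identity. -/
lemma sub_mul_inv_add_mul {ι : Type*} [Fintype ι] [DecidableEq ι] {S D : Matrix ι ι ℝ}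
    (hS : IsUnit S.det) (hD : IsUnit D.det) (hSD : IsUnit (S + D).det) :
    S - S * (S + D)⁻¹ * S = (S⁻¹ + D⁻¹)⁻¹ := by
  symm
  refine Matrix.inv_eq_left_inv ?_
  have h1 : S * S⁻¹ = 1 := Matrix.mul_nonsing_inv _ hS
  have h2 : (S + D) * D⁻¹ = S * D⁻¹ + 1 := by
    rw [add_mul, Matrix.mul_nonsing_inv _ hD]
  have h3 : S * (S + D)⁻¹ * (1 + S * D⁻¹) = S * D⁻¹ := by
    rw [add_comm 1, ← h2, mul_assoc, Matrix.nonsing_inv_mul_cancel_left _ _ hSD]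
  calc (S - S * (S + D)⁻¹ * S) * (S⁻¹ + D⁻¹)
      = S * S⁻¹ + S * D⁻¹ - S * (S + D)⁻¹ * (S * S⁻¹ + S * D⁻¹) := by noncomm_ring
    _ = 1 := by rw [h1, h3]; abel

lemma inv_apply_self_eq_det_div {n : ℕ} (A : Matrix (Fin (n + 1)) (Fin (n + 1)) ℝ)
    (i : Fin (n + 1)) : A⁻¹ i i = (removeRowCol A i i).det / A.det := by
  rw [Matrix.inv_def, Matrix.smul_apply, Matrix.adjugate_fin_succ_eq_det_submatrix,
    Ring.inverse_eq_inv', removeRowCol, (Even.add_self (i : ℕ)).neg_one_pow]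
  rw [smul_eq_mul, one_mul, div_eq_inv_mul]

end MatrixLemmas

end NoisyOU

namespace NoisyOU

/-! ### Mutual information of Gaussian vectors and noisy observations -/

section GaussianInformation

open scoped Matrix

variable {Ω : Type*} {mΩ : MeasurableSpace Ω} {P : Measure Ω} {ι : Type*}

lemma mutualInfo_congr_ae {E F : Type*} [MeasurableSpace E] [MeasurableSpace F] {U U' : Ω → E}
    {V V' : Ω → F} (hU : U =ᵐ[P] U') (hV : V =ᵐ[P] V') :
    mutualInfo U V P = mutualInfo U' V' P := by
  rw [mutualInfo, mutualInfo, Measure.map_congr (hU.prodMk hV), Measure.map_congr hU,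
    Measure.map_congr hV]

lemma covMatrix_add {V N : ι → Ω → ℝ} [IsFiniteMeasure P] (hV : ∀ i, MemLp (V i) 2 P)
    (hN : ∀ i, MemLp (N i) 2 P) (hVN : ∀ i j, cov[V i, N j; P] = 0) :
    covMatrix (fun i ω ↦ V i ω + N i ω) P = covMatrix V P + covMatrix N P := by
  ext i j
  simp only [covMatrix, Matrix.of_apply, Matrix.add_apply]
  change cov[V i + N i, V j + N j; P] = _
  rw [covariance_add_left (hV i) (hN i) ((hV j).add (hN j)),
    covariance_add_right (hV i) (hV j) (hN j), covariance_add_right (hN i) (hV j) (hN j), hVN,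
    covariance_comm (N i) (V j), hVN]
  ring

lemma posDef_covMatrix_of_uncorrelated [DecidableEq ι] {N : ι → Ω → ℝ} (hN : ∀ i, AEMeasurable (N i) P)
    (hcov : ∀ i j, i ≠ j → cov[N i, N j; P] = 0) (hvar : ∀ i, 0 < Var[N i; P]) :
    (covMatrix N P).PosDef := by
  have : covMatrix N P = Matrix.diagonal fun i ↦ Var[N i; P] := by
    ext i j
    rcases eq_or_ne i j with rfl | h
    · simp [covMatrix, covariance_self (hN i)]
    · simp [covMatrix, Matrix.diagonal_apply_ne _ h, hcov i j h]
  rw [this]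
  exact .diagonal hvar

variable [Fintype ι] [DecidableEq ι]

/-- Mutual information of a real Gaussian variable `U` and a Gaussian vector `Y`: half the
logarithm of the ratio of the variance of `U` and its residual variance given `Y`. -/
theorem mutualInfo_eq_of_hasGaussianLaw {U : Ω → ℝ} {Y : ι → Ω → ℝ}
    (hUY : HasGaussianLaw (fun ω ↦ (U ω, fun i ↦ Y i ω)) P) (hY : IsUnit (covMatrix Y P))
    {b : ι → ℝ} (hb : ∀ i, cov[U, Y i; P] = b i) (hU : 0 < Var[U; P])
    (hres : 0 < Var[U; P] - b ⬝ᵥ (covMatrix Y P)⁻¹ *ᵥ b) :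
    mutualInfo U (fun ω i ↦ Y i ω) P ≠ ∞ ∧
      (mutualInfo U (fun ω i ↦ Y i ω) P).toReal =
        1 / 2 * Real.log (Var[U; P] / (Var[U; P] - b ⬝ᵥ (covMatrix Y P)⁻¹ *ᵥ b)) := by
  have := hUY.isProbabilityMeasure
  have hUlp : MemLp U 2 P := hUY.fst.memLp_two
  have hYlp (i : ι) : MemLp (Y i) 2 P := (hUY.snd.eval i).memLp_two
  -- The coefficients of linear regression of $U$ on $Y$: the normal equations `hwb` make the
  -- residual $R$ uncorrelated with each $Y_i$.
  set w : ι → ℝ := (covMatrix Y P)⁻¹ *ᵥ b with hw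
  have hwb : covMatrix Y P *ᵥ w = b := by
    rw [hw, Matrix.mulVec_mulVec, Matrix.mul_nonsing_inv _ ((Matrix.isUnit_iff_isUnit_det _).1 hY),
      Matrix.one_mulVec]
  set R : Ω → ℝ := fun ω ↦ U ω - ∑ i, w i * Y i ω with hR
  have hwYlp (i : ι) : MemLp (fun ω ↦ w i * Y i ω) 2 P := (hYlp i).const_mul _
  have hSlp : MemLp (fun ω ↦ ∑ i, w i * Y i ω) 2 P := memLp_finsetSum _ fun i _ ↦ hwYlp i
  have hRlp : MemLp R 2 P := hUlp.sub hSlp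
  have hRY (i : ι) : cov[R, Y i; P] = 0 := by
    rw [hR, covariance_fun_sub_left hUlp hSlp (hYlp i), covariance_fun_sum_left hwYlp (hYlp i), hb,
      ← hwb]
    simp only [Matrix.mulVec, dotProduct, covMatrix, Matrix.of_apply, covariance_const_mul_left]
    rw [sub_eq_zero]
    exact Finset.sum_congr rfl fun j _ ↦ by rw [covariance_comm, mul_comm]
  have hvarR : Var[R; P] = Var[U; P] - b ⬝ᵥ w := by
    rw [← covariance_self hRlp.aemeasurable, ← covariance_self hUlp.aemeasurable]
    -- Expanding only the second factor gives $\operatorname{Var}R=\operatorname{Cov}(R,U)$, as $R$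
    -- is uncorrelated with $Y$.
    nth_rewrite 2 [hR]
    rw [covariance_fun_sub_right hRlp hUlp hSlp, covariance_fun_sum_right hwYlp hRlp]
    simp_rw [covariance_const_mul_right, hRY]
    rw [hR, covariance_fun_sub_left hUlp hSlp hUlp, covariance_fun_sum_left hwYlp hUlp]
    simp only [covariance_const_mul_left, mul_zero, Finset.sum_const_zero, sub_zero, dotProduct]
    congr 1
    refine Finset.sum_congr rfl fun i _ ↦ ?_
    rw [covariance_comm, hb, mul_comm]
  -- Joint Gaussianity upgrades zero correlation to independence. The criterion concerns two
  -- families, so $R$ becomes a family indexed by `Unit`.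
  have hRYg : HasGaussianLaw (fun ω ↦ ((fun _ : Unit ↦ R ω), fun i ↦ Y i ω)) P := by
    let L : ℝ × (ι → ℝ) →L[ℝ] ℝ := ContinuousLinearMap.fst ℝ ℝ (ι → ℝ) -
      ∑ i, w i • (ContinuousLinearMap.proj (R := ℝ) (φ := fun _ : ι ↦ ℝ) i).comp
        (ContinuousLinearMap.snd ℝ ℝ (ι → ℝ))
    convert! hUY.map_fun ((ContinuousLinearMap.pi fun _ : Unit ↦ L).prod
      (ContinuousLinearMap.snd ℝ ℝ (ι → ℝ))) using 1
    ext ω <;> simp [L, hR]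
  have hind : IndepFun R (fun ω i ↦ Y i ω) P :=
    (HasGaussianLaw.indepFun_of_covariance_eval (X := fun _ : Unit ↦ R) (Y := Y) hRYg
      fun _ i ↦ hRY i).comp (measurable_pi_apply ()) measurable_id
  rw [← hvarR] at hres ⊢
  exact mutualInfo_eq_of_gaussian_residual (h := fun y ↦ ∑ i, w i * y i) (by fun_prop)
    hUY.snd.aemeasurable hUY.fst (hRYg.fst.eval ()) (.of_forall fun ω ↦ by simp [hR]) hind hU hres

/-- Mutual information of `U` and noisy observations of a Gaussian vector `V`, when the covariances
of `U` and `V` are proportional to one row of the covariance matrix of `V`. -/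
theorem mutualInfo_noisy_observations {U : Ω → ℝ} {V N : ι → Ω → ℝ}
    (hUV : HasGaussianLaw (fun ω ↦ (U ω, fun i ↦ V i ω)) P)
    (hN : HasGaussianLaw (fun ω i ↦ N i ω) P)
    (hind : IndepFun (fun ω ↦ (U ω, fun i ↦ V i ω)) (fun ω i ↦ N i ω) P)
    (hSpos : (covMatrix V P).PosDef) (hDpos : (covMatrix N P).PosDef) {β : ℝ} {l : ι}
    (hrow : ∀ i, cov[U, V i; P] = β * cov[V l, V i; P])
    (hres : 0 < Var[U; P] - β ^ 2 * Var[V l; P]) :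
    mutualInfo U (fun ω i ↦ V i ω + N i ω) P ≠ ∞ ∧
      (mutualInfo U (fun ω i ↦ V i ω + N i ω) P).toReal =
        1 / 2 * Real.log (Var[U; P] /
          (Var[U; P] - β ^ 2 * Var[V l; P] + β ^ 2 * (precisionSum V N P)⁻¹ l l)) := by
  have := hUV.isProbabilityMeasure
  set S := covMatrix V P with hS
  set D := covMatrix N P with hD
  have hUlp : MemLp U 2 P := hUV.fst.memLp_two
  have hVlp (i : ι) : MemLp (V i) 2 P := (hUV.snd.eval i).memLp_two
  have hNlp (i : ι) : MemLp (N i) 2 P := (hN.eval i).memLp_two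
  have hVN (i j : ι) : cov[V i, N j; P] = 0 := by
    refine IndepFun.covariance_eq_zero ?_ (hVlp i) (hNlp j)
    exact hind.comp ((measurable_pi_apply i).comp measurable_snd) (measurable_pi_apply j)
  have hUN (j : ι) : cov[U, N j; P] = 0 :=
    (hind.comp measurable_fst (measurable_pi_apply j)).covariance_eq_zero hUlp (hNlp j)
  have hcov : covMatrix (fun i ω ↦ V i ω + N i ω) P = S + D := covMatrix_add hVlp hNlp hVN
  have hb (i : ι) : cov[U, fun ω ↦ V i ω + N i ω; P] = (β • S l) i := by
    change cov[U, V i + N i; P] = _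
    rw [covariance_add_right hUlp (hVlp i) (hNlp i), hUN, add_zero, hrow]
    rfl
  have hjoint : HasGaussianLaw (fun ω ↦ (U ω, fun i ↦ V i ω + N i ω)) P := by
    let q : (ℝ × (ι → ℝ)) × (ι → ℝ) →L[ℝ] ℝ × (ι → ℝ) := ContinuousLinearMap.fst ℝ _ _
    exact (hind.hasGaussianLaw hUV hN).map_fun
      (((ContinuousLinearMap.fst ℝ _ _).comp q).prod
        ((ContinuousLinearMap.snd ℝ _ _).comp q + ContinuousLinearMap.snd ℝ _ _))
  have hsymm : S.IsSymm := by
    ext i j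
    simp [hS, covMatrix, covariance_comm]
  have hSD := hSpos.add hDpos
  -- As $b$ is a multiple of a row of the symmetric matrix $S$, the quadratic form is $\beta^2$
  -- times the $(l,l)$ entry of $S(S+D)^{-1}S$, to which Woodbury applies.
  have hquad : (β • S l) ⬝ᵥ (S + D)⁻¹ *ᵥ (β • S l) =
      β ^ 2 * Var[V l; P] - β ^ 2 * (precisionSum V N P)⁻¹ l l := by
    have hW := congrFun (congrFun (sub_mul_inv_add_mul
      ((Matrix.isUnit_iff_isUnit_det _).1 hSpos.isUnit)
      ((Matrix.isUnit_iff_isUnit_det _).1 hDpos.isUnit)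
      ((Matrix.isUnit_iff_isUnit_det _).1 hSD.isUnit)) l) l
    have hll : S l l = Var[V l; P] := covariance_self (hVlp l).aemeasurable
    have hq : (S * (S + D)⁻¹ * S) l l = S l ⬝ᵥ (S + D)⁻¹ *ᵥ S l := by
      rw [mul_assoc, Matrix.mul_apply']
      congr 1
      ext j
      rw [Matrix.mul_apply']
      exact congrArg _ (funext fun k ↦ hsymm.apply l k)
    rw [Matrix.sub_apply, hll, hq] at hW
    rw [Matrix.mulVec_smul, smul_dotProduct, dotProduct_smul, smul_eq_mul, smul_eq_mul,
      precisionSum, ← hW]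
    ring
  have hApos : 0 < (precisionSum V N P)⁻¹ l l :=
    (hSpos.inv.add hDpos.inv).inv.diag_pos
  have hres' : 0 < Var[U; P] - β ^ 2 * Var[V l; P] + β ^ 2 * (precisionSum V N P)⁻¹ l l := by
    positivity
  have hU : 0 < Var[U; P] := by
    have := mul_nonneg (sq_nonneg β) (variance_nonneg (V l) P)
    linarith
  have heq : Var[U; P] - (β • S l) ⬝ᵥ (S + D)⁻¹ *ᵥ (β • S l) =
      Var[U; P] - β ^ 2 * Var[V l; P] + β ^ 2 * (precisionSum V N P)⁻¹ l l := by
    rw [hquad]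
    ring
  have h := mutualInfo_eq_of_hasGaussianLaw hjoint (hcov ▸ hSD.isUnit) hb hU
    (by rwa [hcov, heq])
  rwa [hcov, heq] at h

end GaussianInformation

/-! ### Nondegeneracy and regression for the sampled process -/

section OrnsteinUhlenbeckInformation

variable {Ω : Type*} {mΩ : MeasurableSpace Ω} {P : Measure Ω} {κ θ σ x₀ : ℝ}
  {X W : ℝ≥0 → Ω → ℝ}

/-- Up to invertible diagonal factors, the covariance matrix is that of Brownian motion under the
time change $s\mapsto e^{2\kappa s}-1$, hence invertible by `isUnit_of_min`; a positive semidefinite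
invertible matrix is positive definite. -/
lemma IsOrnsteinUhlenbeck.posDef_covMatrix (hκ : 0 < κ) (hσ : σ ≠ 0)
    (hX : IsOrnsteinUhlenbeck κ θ σ x₀ X W P) {n : ℕ} {τ : Fin (n + 1) → ℝ≥0}
    (hτ : StrictMono τ) (hτ0 : 0 < τ 0) : (covMatrix (fun i ↦ X (τ i)) P).PosDef := by
  have hG := hX.isGaussianProcess hκ.ne'
  have := hG.isProbabilityMeasure
  have hpsd := posSemidef_covMatrix (V := fun i ↦ X (τ i)) fun i ↦
    (hG.hasGaussianLaw_eval (τ i)).memLp_two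
  set a : ℝ≥0 → ℝ := fun s ↦ Real.exp (2 * κ * s) - 1 with ha
  have hmono : StrictMono a := fun s t hst ↦ by
    have : (s : ℝ) < t := hst
    simp only [ha]
    gcongr
  have hfac : covMatrix (fun i ↦ X (τ i)) P =
      Matrix.diagonal (fun i ↦ σ ^ 2 / (2 * κ) * Real.exp (-κ * τ i)) *
        (Matrix.of fun i j ↦ min (a (τ i)) (a (τ j))) *
        Matrix.diagonal (fun i ↦ Real.exp (-κ * τ i)) := by
    ext i j
    rw [Matrix.mul_diagonal, Matrix.diagonal_mul, Matrix.of_apply, ← hmono.monotone.map_min,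
      covMatrix, Matrix.of_apply, hX.covariance hκ.ne']
    simp only [ha]
    ring
  refine hpsd.posDef_iff_isUnit.2 ?_
  rw [hfac]
  refine (IsUnit.mul ?_ (isUnit_of_min (hmono.comp hτ) ?_)).mul ?_
  · rw [Matrix.isUnit_diagonal, Pi.isUnit_iff]
    intro i
    have : 0 < σ ^ 2 := by positivity
    exact (by positivity : σ ^ 2 / (2 * κ) * Real.exp (-κ * τ i) ≠ 0).isUnit
  · simpa [ha] using hmono hτ0
  · rw [Matrix.isUnit_diagonal, Pi.isUnit_iff]
    exact fun i ↦ (Real.exp_pos _).ne'.isUnit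

lemma IsOrnsteinUhlenbeck.variance (hκ : κ ≠ 0) (hX : IsOrnsteinUhlenbeck κ θ σ x₀ X W P)
    (s : ℝ≥0) : Var[X s; P] = σ ^ 2 / (2 * κ) * (1 - Real.exp (-2 * κ * s)) := by
  have h1 : Real.exp (-κ * s) * Real.exp (-κ * s) = Real.exp (-2 * κ * s) := by
    rw [← Real.exp_add]; ring_nf
  have h2 : Real.exp (-2 * κ * s) * Real.exp (2 * κ * s) = 1 := by
    rw [← Real.exp_add]; simp
  rw [← covariance_self (hX.aemeasurable s), hX.covariance hκ, min_self]
  linear_combination σ ^ 2 / (2 * κ) * h2 +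
    σ ^ 2 / (2 * κ) * (Real.exp (2 * κ * s) - 1) * h1

/-- The regression property of the Ornstein–Uhlenbeck process. -/
lemma IsOrnsteinUhlenbeck.covariance_of_le (hκ : κ ≠ 0) (hX : IsOrnsteinUhlenbeck κ θ σ x₀ X W P)
    {r s t : ℝ≥0} (hrs : r ≤ s) (hst : s ≤ t) :
    cov[X t, X r; P] = Real.exp (-κ * (t - s)) * cov[X s, X r; P] := by
  rw [hX.covariance hκ, hX.covariance hκ, min_eq_right hrs, min_eq_right (hrs.trans hst)]
  have h : Real.exp (-κ * t) = Real.exp (-κ * (t - s)) * Real.exp (-κ * s) := by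
    rw [← Real.exp_add]; ring_nf
  rw [h]
  ring

end OrnsteinUhlenbeckInformation

end NoisyOU

/-! ### The value of information formula -/

theorem proposition1 {Ω : Type*} [MeasurableSpace Ω] (P : Measure Ω) [IsProbabilityMeasure P]
    (κ θ σ x₀ : ℝ) (hκ : 0 < κ) (hσ : 0 < σ)
    -- the latent process, the Brownian motion that drives it, the noise and the observed process
    (X W N Y : ℝ≥0 → Ω → ℝ)
    (hX : IsOrnsteinUhlenbeck κ θ σ x₀ X W P)
    -- the sampling times `τ i`, the receiving times `τ' i` and the current time `t`
    (n : ℕ) (τ τ' : Fin (n + 1) → ℝ≥0) (t : ℝ≥0)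
    (hτ_pos : 0 < τ 0) (hτ_mono : StrictMono τ)
    (hτ' : ∀ i, τ i < τ' i) (ht : τ' (Fin.last n) < t)
    -- centred Gaussian noise with diagonal, nondegenerate covariance matrix, independent of `X`
    (hN_gauss : HasGaussianLaw (fun ω i ↦ N (τ' i) ω) P)
    (hN_mean : ∀ i, ∫ ω, N (τ' i) ω ∂P = 0)
    (hN_cov : ∀ i j, i ≠ j → cov[N (τ' i), N (τ' j); P] = 0)
    (hN_var : ∀ i, 0 < Var[N (τ' i); P])
    (hXN : IndepFun (fun ω s ↦ X s ω) (fun ω i ↦ N (τ' i) ω) P)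
    (hY : ∀ i, ∀ᵐ ω ∂P, Y (τ' i) ω = X (τ i) ω + N (τ' i) ω)
    (A : Matrix (Fin (n + 1)) (Fin (n + 1)) ℝ)
    (hA : A = precisionSum (fun i ↦ X (τ i)) (fun i ↦ N (τ' i)) P) :
    -- the inverses in `A` and the quotient by `det A` are genuine
    IsUnit (covMatrix (fun i ↦ X (τ i)) P) ∧ IsUnit (covMatrix (fun i ↦ N (τ' i)) P) ∧
    A.det ≠ 0 ∧
    voi X Y τ' P t ≠ ∞ ∧
    (voi X Y τ' P t).toReal =
      1 / 2 * Real.log ((1 - Real.exp (-2 * κ * (t : ℝ))) /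
          (1 - Real.exp (-2 * κ * ((t : ℝ) - (τ (Fin.last n) : ℝ)))))
        - 1 / 2 * Real.log (1 +
            2 * κ / (σ ^ 2 * (Real.exp (2 * κ * ((t : ℝ) - (τ (Fin.last n) : ℝ))) - 1)) *
              ((removeRowCol A (Fin.last n) (Fin.last n)).det / A.det)) := by
  have hκ' := hκ.ne'
  have hG := hX.isGaussianProcess hκ'
  set l := Fin.last n with hl
  have hlt : τ l < t := (hτ' l).trans ht
  have hltR : (τ l : ℝ) < t := hlt
  have hSpos := hX.posDef_covMatrix hκ hσ.ne' hτ_mono hτ_pos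
  have hDpos : (covMatrix (fun i ↦ N (τ' i)) P).PosDef :=
    posDef_covMatrix_of_uncorrelated (fun i ↦ (hN_gauss.eval i).aemeasurable) hN_cov hN_var
  have hApos : A.PosDef := hA ▸ hSpos.inv.add hDpos.inv
  have hXg : HasGaussianLaw (fun ω ↦ (X t ω, fun i ↦ X (τ i) ω)) P := by
    let I : Finset ℝ≥0 := insert t (Finset.univ.image τ)
    let p (s : I) : (I → ℝ) →L[ℝ] ℝ := ContinuousLinearMap.proj s
    exact (hG.hasGaussianLaw I).map_fun
      ((p ⟨t, by simp [I]⟩).prod (ContinuousLinearMap.pi fun i ↦ p ⟨τ i, by simp [I]⟩))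
  have hind : IndepFun (fun ω ↦ (X t ω, fun i ↦ X (τ i) ω)) (fun ω i ↦ N (τ' i) ω) P :=
    hXN.comp (φ := fun x : ℝ≥0 → ℝ ↦ (x t, fun i ↦ x (τ i))) (by fun_prop) measurable_id
  have hvoi : voi X Y τ' P t =
      mutualInfo (X t) (fun ω i ↦ X (τ i) ω + N (τ' i) ω) P := by
    refine mutualInfo_congr_ae .rfl ?_
    filter_upwards [ae_all_iff.2 hY] with ω hω
    exact funext hω
  set β := Real.exp (-κ * (t - τ l)) with hβ
  have hβ2 : β ^ 2 = Real.exp (-2 * κ * (t - τ l)) := by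
    rw [hβ, ← Real.exp_nat_mul]
    push_cast
    ring_nf
  have hβt : β ^ 2 * Real.exp (-2 * κ * τ l) = Real.exp (-2 * κ * t) := by
    rw [hβ2, ← Real.exp_add]
    ring_nf
  have hβE : Real.exp (2 * κ * (t - τ l)) = (β ^ 2)⁻¹ := by
    rw [hβ2, ← Real.exp_neg]
    ring_nf
  have hβ0 : 0 < β := Real.exp_pos _
  have hβ1 : β ^ 2 < 1 := by
    rw [hβ2, Real.exp_lt_one_iff]
    nlinarith
  have ht0 : Real.exp (-2 * κ * t) < 1 := by
    rw [Real.exp_lt_one_iff]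
    have : (0 : ℝ) ≤ τ l := (τ l).2
    nlinarith
  -- The variance accumulated over $(t_n,t]$, that is, the residual variance of $X_t$ given a
  -- noiseless $X_{t_n}$.
  have hresidual : Var[X t; P] - β ^ 2 * Var[X (τ l); P] = σ ^ 2 / (2 * κ) * (1 - β ^ 2) := by
    rw [hX.variance hκ', hX.variance hκ', ← hβt]
    ring
  have hpos : 0 < σ ^ 2 / (2 * κ) * (1 - β ^ 2) := by
    have := sub_pos.2 hβ1
    positivity
  obtain ⟨hfin, hval⟩ := mutualInfo_noisy_observations hXg hN_gauss hind hSpos hDpos (l := l)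
    (fun i ↦ hX.covariance_of_le hκ' (hτ_mono.monotone (Fin.le_last i)) hlt.le)
    (by rw [← hβ, hresidual]; exact hpos)
  refine ⟨hSpos.isUnit, hDpos.isUnit, hApos.det_pos.ne', hvoi ▸ hfin, ?_⟩
  have hr : 0 < (removeRowCol A l l).det / A.det := by
    rw [← inv_apply_self_eq_det_div]
    exact hApos.inv.diag_pos
  rw [hvoi, hval, ← hβ, hresidual, ← hA, inv_apply_self_eq_det_div, hβE, ← hβ2, hX.variance hκ']
  set r := (removeRowCol A l l).det / A.det
  set b := β ^ 2
  have hb0 : 0 < b := by positivity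
  have h1 : 0 < 1 - b := sub_pos.2 hβ1
  have h2 : 0 < 1 - Real.exp (-2 * κ * t) := sub_pos.2 ht0
  have h3 : b⁻¹ - 1 = (1 - b) / b := by field_simp
  -- With the logarithms merged, the arguments agree because
  -- $\frac{\sigma^2}{2\kappa}(1-b)+br=\frac{\sigma^2}{2\kappa}(1-b)\bigl(1+\frac{2\kappa}{\sigma^2(b^{-1}-1)}r\bigr)$.
  rw [← mul_sub, h3, ← Real.log_div (by positivity) (by positivity)]
  congr 2
  field_simp
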